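/- Consider a wireless network with finite node set $\mathcal N$, a symmetric neighbour relation on $\mathcal N$, and a finite set $\mathcal F$ of flows; flow $f$ has source nodes $\mathcal S_f$ and destination nodes $\mathcal D_f$. In each frame $t=0,1,2,\dots$ a schedule $(\mathbf s,\mathbf p)$ is chosen, with roles $s_n\in\{0,1\}$ ($1$ = transmit) and power fractions $p_{n,m}\ge 0$ such that $p_{n,m}=0$ if $n,m$ are not neighbours, $p_{n,m}\le s_n(1-s_m)$ (half-duplex) and $\sum_m p_{n,m}\le 1$; there is no limit on the number of simultaneous links of a node. Links are interference-free, and the link from $n$ to $m$ has capacity $$c_{n,m}=\alpha_1T_{\mathrm f}W\log_2\Bigl(1+\alpha_2\frac{p_{n,m}P_n\,G_{n,m}\,g_{n,m}}{W N_0}\Bigr),\qquad G_{n,m}=\bigl|\mathbf w^{\mathrm r}_{n,m}\mathbf H_{n,m}\mathbf w^{\mathrm t}_{n,m}\bigr|^2 ,$$ where the unit beamforming vectors $\mathbf w^{\mathrm r}_{n,m},\mathbf w^{\mathrm t}_{n,m}$ maximise $G_{n,m}$, the constants $\alpha_1,\alpha_2,T_{\mathrm f},W,N_0,P_n$ are positive,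 and $\mathbf H_{n,m}\ne 0$, $g_{n,m}>0$ (path gain) for neighbours; all of these are constant in time. Node $n$ holds a queue $q_n^f\ge 0$ for each flow (real-valued lengths, arbitrary deterministic initial values). A scheduling policy chooses in each frame, from the past, possibly with randomisation, and without knowledge of the current and future arrivals, a schedule and rates $c_{n,m}^f\ge 0$ with $\sum_f c^f_{n,m}\le c_{n,m}$ and $\sum_m c^f_{n,m}\le q_n^f$, and the queues evolve by $$q_n^f(t+1)=q_n^f(t)+\sum_m\bigl(c^f_{m,n}(t)-c^f_{n,m}(t)\bigr)+a_n^f(t)\quad(n\notin\mathcal D_f),\qquad q_n^f(t)=0\quad(n\in\mathcal D_f).$$ The arrival vectors $\mathbf a(t)=(a_n^f(t))_{n,f}\ge 0$, with $a_n^f(t)=0$ for $n\notin\mathcal S_f$, are independent and identically distributed over the frames $t$ and have mean rate vector $\mathbf x=\mathbb E\,\mathbf a(t)$. The network is called stable if, with probability one, the total queue length $|\mathbf q(t)|_1$ does not grow unbounded, in the sense that $$\lim_{B\to\infty}\ \limsup_{T\to\infty}\ \frac1T\,\#\{t<T:\ |\mathbf q(t)|_1>B\}=0 .$$ The throughput capacity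 region $\Lambda$ is the set of mean rate vectors $\mathbf x$ for which there exist an arrival process of mean $\mathbf x$ and a scheduling policy such that the network is stable. Maximum Back Pressure scheduling selects, in each frame and given $\mathbf q=\mathbf q(t)$, a flow $f^*_{n,m}\in\arg\max_f(q_n^f-q_m^f)$ for each pair $(n,m)$. It assigns to a schedule the rates $$c^f_{n,m}=\begin{cases}\min\bigl(c_{n,m},\,q_n^f\,\xi_{n,m}\bigr)& f=f^*_{n,m},\\ 0&\text{otherwise,}\end{cases}\qquad \xi_{n,m}=\frac{c_{n,m}}{\sum_{m':\,f^*_{n,m'}=f^*_{n,m}}c_{n,m'}}$$ (with $c^f_{n,m}=0$ if $c_{n,m}=0$), and uses a schedule that maximises $$\sum_{n}\sum_{m} c^{f^*_{n,m}}_{n,m}\,\bigl(q_n^{f^*_{n,m}}-q_m^{f^*_{n,m}}\bigr)$$ over all feasible schedules, together with these rates. Ties may be broken in any way. **Proposition.** Maximum Back Pressure scheduling is throughput optimal: for every rate vector $\mathbf x$ strictly inside the throughput capacity region, that is, with $(1+\varepsilon)\mathbf x\in\Lambda$ for some $\varepsilon>0$, and for every arrival process of mean $\mathbf x$, the network operated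 by Maximum Back Pressure scheduling is stable. -/

import Mathlib

open MeasureTheory ProbabilityTheory Filter
open scoped BigOperators

noncomputable section

namespace MmWave

/-- A multi-hop mmWave network with node set `N` and set of traffic flows `F`.

The topology is given by the neighbour relation `graph.Adj`; every edge stands for the two directed
links between its end points.  Any neighbour relation is allowed (so in particular one in which no
two user terminals and no two base stations are adjacent).  Every node has at least as many transmit
and receive ports as neighbours, so that the number of ports puts no constraint on a schedule. -/
structure Network (N F : Type*) where
  /-- neighbour relation -/
  graph : SimpleGraph N
  /-- number of antennas of each node -/
  antennas : N → ℕ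
  /-- small scale fading matrix of the channel from `n` to `m` -/
  channel : (n m : N) → Matrix (Fin (antennas m)) (Fin (antennas n)) ℂ
  /-- transmit beamforming vector of `n` towards `m` -/
  txBeam : (n m : N) → EuclideanSpace ℂ (Fin (antennas n))
  /-- receive beamforming vector of `m` for the port assigned to `n` -/
  rxBeam : (n m : N) → EuclideanSpace ℂ (Fin (antennas m))
  /-- macroscopic path gain from `n` to `m`, in linear scale -/
  pathGain : N → N → ℝ
  /-- total transmit power of each node -/
  power : N → ℝ
  /-- system bandwidth -/
  bandwidth : ℝ
  /-- noise power spectral density -/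
  noise : ℝ
  /-- frame duration -/
  frame : ℝ
  /-- bandwidth penalty factor -/
  bwPenalty : ℝ
  /-- power penalty factor -/
  powPenalty : ℝ
  /-- nodes at which packets of a flow are produced -/
  source : F → Finset N
  /-- nodes at which packets of a flow leave the network -/
  dest : F → Finset N
  txBeam_norm : ∀ n m, graph.Adj n m → ‖txBeam n m‖ = 1
  rxBeam_norm : ∀ n m, graph.Adj n m → ‖rxBeam n m‖ = 1
  /-- the beamforming vectors maximise the signal-to-noise ratio of their own link -/
  beam_opt : ∀ n m, graph.Adj n m →
    ∀ (u : EuclideanSpace ℂ (Fin (antennas m))) (v : EuclideanSpace ℂ (Fin (antennas n))),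
      ‖u‖ = 1 → ‖v‖ = 1 →
      ‖dotProduct u.ofLp ((channel n m).mulVec v.ofLp)‖ ^ 2 ≤
        ‖dotProduct (rxBeam n m).ofLp ((channel n m).mulVec (txBeam n m).ofLp)‖ ^ 2
  /-- neighbours can hear each other -/
  channel_ne_zero : ∀ n m, graph.Adj n m → channel n m ≠ 0
  pathGain_pos : ∀ n m, graph.Adj n m → 0 < pathGain n m
  power_pos : ∀ n, 0 < power n
  bandwidth_pos : 0 < bandwidth
  noise_pos : 0 < noise
  frame_pos : 0 < frame
  bwPenalty_pos : 0 < bwPenalty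
  powPenalty_pos : 0 < powPenalty

/-- A schedule for one frame: the transmission role of each node (`true` for transmitting, `false`
for receiving) and the fraction of its power that each node allocates towards each other node. -/
structure Schedule (N : Type*) where
  role : N → Bool
  alloc : N → N → ℝ

variable {N F : Type*}

/-- Beamforming gain of the link from `n` to `m`. -/
def Network.beamGain (net : Network N F) (n m : N) : ℝ :=
  ‖dotProduct (net.rxBeam n m).ofLp ((net.channel n m).mulVec (net.txBeam n m).ofLp)‖ ^ 2

/-- Capacity, in bits per frame, of the interference-free link from `n` to `m` when `n` allocates
the fraction `r` of its power to it. -/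
def Network.linkRate (net : Network N F) (n m : N) (r : ℝ) : ℝ :=
  net.bwPenalty * net.frame * net.bandwidth *
    Real.logb 2 (1 + net.powPenalty *
      ((r * net.power n) * net.beamGain n m * net.pathGain n m / (net.bandwidth * net.noise)))

/-- Link capacities under a schedule. -/
def Network.cap (net : Network N F) (σ : Schedule N) (n m : N) : ℝ :=
  net.linkRate n m (σ.alloc n m)

/-- The feasible schedules: power is only allocated to links, the half-duplex constraint
`p n m ≤ s n * (1 - s m)`, and the power budget of each transmitter. -/
structure Network.Feasible [Fintype N] (net : Network N F) (σ : Schedule N) : Prop where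
  nonneg : ∀ n m, 0 ≤ σ.alloc n m
  link : ∀ n m, ¬ net.graph.Adj n m → σ.alloc n m = 0
  half_duplex : ∀ n m,
    σ.alloc n m ≤ ((σ.role n).toNat : ℝ) * (1 - ((σ.role m).toNat : ℝ))
  budget : ∀ n, ∑ m, σ.alloc n m ≤ 1

section MBP

variable [Fintype N] [DecidableEq F]

/-- Share `ξ` of the link from `n` to `m` among the links out of `n` that serve the same flow, when
`φ n m` is the flow selected on each link (`0 / 0 = 0` is harmless, as `ξ` is only used together
with the capacity of the link). -/
def Network.share (net : Network N F) (φ : N → N → F) (σ : Schedule N) (n m : N) : ℝ :=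
  net.cap σ n m / ∑ m' with φ n m' = φ n m, net.cap σ n m'

/-- Rate that Maximum Back Pressure assigns to flow `f` on the link from `n` to `m`, for queue
lengths `q`, selected flows `φ` and schedule `σ`. -/
def Network.mbpRate (net : Network N F) (q : N → F → ℝ) (φ : N → N → F) (σ : Schedule N)
    (n m : N) (f : F) : ℝ :=
  if f = φ n m then min (net.cap σ n m) (q n f * net.share φ σ n m) else 0

/-- Total back pressure of a schedule: the sum over the links of the rate of the selected flow
times its queue differential. -/
def Network.mbpWeight (net : Network N F) (q : N → F → ℝ) (φ : N → N → F) (σ : Schedule N) : ℝ :=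
  ∑ n, ∑ m, net.mbpRate q φ σ n m (φ n m) * (q n (φ n m) - q m (φ n m))

/-- `σ` and the rate assignment `c` are a decision of Maximum Back Pressure for queue lengths `q`:
on each link a flow with the largest queue differential is selected, the schedule maximises the
total back pressure over all feasible schedules, and the rates are those of the algorithm.  Ties
may be broken in any way. -/
def Network.IsMBPDecision (net : Network N F) (q : N → F → ℝ) (σ : Schedule N)
    (c : N → N → F → ℝ) : Prop :=
  ∃ φ : N → N → F,
    (∀ n m f, q n f - q m f ≤ q n (φ n m) - q m (φ n m)) ∧
    net.Feasible σ ∧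
    (∀ σ', net.Feasible σ' → net.mbpWeight q φ σ' ≤ net.mbpWeight q φ σ) ∧
    c = net.mbpRate q φ σ

end MBP

section Dynamics

variable [Fintype N] [DecidableEq N] [Fintype F]

/-- The network operated by some scheduling policy, on the probability space `(Ω, μ)`, with arrivals
of mean rate vector `x`.

The arrival vectors of the frames are independent and identically distributed with mean `x` (the
coordinates of one frame may depend on each other); `ℱ t` is the information available when frame
`t` is scheduled.  The policy, which may be randomised and use the whole past, selects in each frame
a feasible schedule and the rates at which the flows are served on the links, without knowledge of
the arrivals of the current and future frames. -/
structure Operation (net : Network N F) {Ω : Type*} [mΩ : MeasurableSpace Ω] (μ : Measure Ω)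
    (x : N → F → ℝ) where
  /-- information available to the scheduler -/
  ℱ : Filtration ℕ mΩ
  /-- arrivals -/
  a : ℕ → Ω → N → F → ℝ
  /-- schedules -/
  σ : ℕ → Ω → Schedule N
  /-- rate `c t ω n m f` of the link from `n` to `m` dedicated to flow `f` -/
  c : ℕ → Ω → N → N → F → ℝ
  /-- queue lengths -/
  q : ℕ → Ω → N → F → ℝ
  /-- initial queue lengths -/
  q₀ : N → F → ℝ
  a_nonneg : ∀ t ω n f, 0 ≤ a t ω n f
  a_source : ∀ t ω n f, n ∉ net.source f → a t ω n f = 0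
  a_measurable : ∀ t, Measurable[ℱ (t + 1)] (a t)
  a_indep : ∀ t, Indep (MeasurableSpace.comap (a t) inferInstance) (ℱ t) μ
  a_identDistrib : ∀ t, IdentDistrib (a t) (a 0) μ μ
  a_integrable : ∀ t n f, Integrable (fun ω => a t ω n f) μ
  a_mean : ∀ t n f, ∫ ω, a t ω n f ∂μ = x n f
  role_measurable : ∀ t, Measurable[ℱ t] (fun ω => (σ t ω).role)
  alloc_measurable : ∀ t, Measurable[ℱ t] (fun ω => (σ t ω).alloc)
  c_measurable : ∀ t, Measurable[ℱ t] (c t)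
  feasible : ∀ t ω, net.Feasible (σ t ω)
  c_nonneg : ∀ t ω n m f, 0 ≤ c t ω n m f
  /-- the flows share the capacity of each link -/
  c_le_cap : ∀ t ω n m, ∑ f, c t ω n m f ≤ net.cap (σ t ω) n m
  /-- no more packets are sent than there are in the queue -/
  c_le_queue : ∀ t ω n f, ∑ m, c t ω n m f ≤ q t ω n f
  q₀_nonneg : ∀ n f, 0 ≤ q₀ n f
  q₀_dest : ∀ n f, n ∈ net.dest f → q₀ n f = 0
  q_zero : ∀ ω, q 0 ω = q₀
  q_succ : ∀ t ω n f, q (t + 1) ω n f =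
    if n ∈ net.dest f then 0
    else q t ω n f + ∑ m, (c t ω m n f - c t ω n m f) + a t ω n f

variable {net : Network N F} {Ω : Type*} [MeasurableSpace Ω] {μ : Measure Ω} {x : N → F → ℝ}

/-- The network is stable: with probability one the total queue length does not grow unbounded, in
the sense that the long-run fraction of frames in which it exceeds a level `B` is arbitrarily small
for `B` large enough. -/
def Operation.Stable (R : Operation net μ x) : Prop :=
  ∀ᵐ ω ∂μ, ∀ δ : ℝ, 0 < δ → ∃ B : ℝ, ∀ᶠ T : ℕ in atTop,
    (({t ∈ Finset.range T | B < ∑ n, ∑ f, R.q t ω n f}.card : ℕ) : ℝ) ≤ δ * T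

/-- The network is operated by Maximum Back Pressure scheduling. -/
def Operation.IsMBP [DecidableEq F] (R : Operation net μ x) : Prop :=
  ∀ t ω, net.IsMBPDecision (R.q t ω) (R.σ t ω) (R.c t ω)

/-- The throughput capacity region: the rate vectors for which some scheduling policy makes the
network stable. -/
def Network.capacityRegion (net : Network N F) : Set (N → F → ℝ) :=
  {x | ∃ (Ω : Type) (_ : MeasurableSpace Ω) (μ : Measure Ω) (_ : IsProbabilityMeasure μ)
    (R : Operation net μ x), R.Stable}

end Dynamics

end MmWave

end

/-! The proof is a Lyapunov drift argument along sample paths. Arrivals have only a first moment and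
the queue process need not be Markov, so the potential is the smoothed norm `√(B² + |q|²)`, which
grows at most linearly in the arrivals, and expectations are replaced by laws of large numbers.

Outer bound (`Network.sum_mul_le_of_mem_capacityRegion`): give queues weights `w ≥ 0` that vanish at
destinations. If no schedule drains more than `M` of weighted queue per frame, then `w · y ≤ M` for
every `y` in the capacity region; otherwise the weighted queue grows linearly under any policy. With
`w = q` this bounds `(1 + ε) q · x` by the largest value of capacity times positive queue
differential, which Maximum Back Pressure attains up to a constant: the limit `q ξ` binds only on
queues shorter than a fixed total rate.

Negative drift (`Network.exists_backPressure_ge`): the slack `ε` must dominate a multiple of `|q|₁`.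
Along a path to a destination, each differential is controlled by the back pressure of one link,
hence so is the queue. Pairs without such a path have zero arrival rate by the outer bound, so their
queues stay below the initial total.

Stability (`Operation.IsMBP.stable`): arrivals are split at a level `K`. The excess has small mean;
the truncated part gives bounded orthogonal increments, which average to zero; the second-order term
is of order `1/B`. When `|q|₁ > B` the back pressure contributes a drift of at most `-δ/2`, and as
the potential is nonnegative this can happen only in a small fraction of the frames. -/

namespace MmWave

/-! ### Link capacities and the back pressure of a schedule. -/

section Rates

variable {N F : Type*} (net : Network N F)

/-- Standard basis vectors are admissible beams and pick out a single entry of the channel matrix,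
so the optimal gain is at least the squared modulus of a nonzero entry. -/
theorem Network.beamGain_pos {n m : N} (h : net.graph.Adj n m) : 0 < net.beamGain n m := by
  obtain ⟨i, j, hij⟩ : ∃ i j, net.channel n m i j ≠ 0 := by
    by_contra! hc
    exact net.channel_ne_zero n m h (by ext i j; simpa using hc i j)
  refine lt_of_lt_of_le ?_ (net.beam_opt n m h (EuclideanSpace.single i 1)
    (EuclideanSpace.single j 1) (by simp) (by simp))
  simpa using pow_pos (norm_pos_iff.2 hij) 2

theorem Network.linkRate_zero (n m : N) : net.linkRate n m 0 = 0 := by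
  simp [Network.linkRate]

theorem Network.snr_pos {n m : N} (h : net.graph.Adj n m) :
    0 < net.power n * net.beamGain n m * net.pathGain n m / (net.bandwidth * net.noise) := by
  have := net.beamGain_pos h
  have := net.power_pos n
  have := net.pathGain_pos n m h
  have := net.bandwidth_pos
  have := net.noise_pos
  positivity

theorem Network.linkRate_mono {n m : N} (h : net.graph.Adj n m) {r s : ℝ} (hr : 0 ≤ r)
    (hrs : r ≤ s) : net.linkRate n m r ≤ net.linkRate n m s := by
  have h1 := net.snr_pos h
  have h2 := net.powPenalty_pos
  have h3 := net.bandwidth_pos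
  have h4 := net.frame_pos
  have h5 := net.bwPenalty_pos
  have e : ∀ z : ℝ, z * net.power n * net.beamGain n m * net.pathGain n m /
      (net.bandwidth * net.noise) = z * (net.power n * net.beamGain n m * net.pathGain n m /
      (net.bandwidth * net.noise)) := fun z => by ring
  unfold Network.linkRate
  rw [e, e]
  refine mul_le_mul_of_nonneg_left ?_ (by positivity)
  exact Real.logb_le_logb_of_le (by norm_num) (by positivity) (by gcongr)

theorem Network.linkRate_one_pos {n m : N} (h : net.graph.Adj n m) :
    0 < net.linkRate n m 1 := by
  have h1 := net.snr_pos h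
  have h2 := net.powPenalty_pos
  have h3 := net.bandwidth_pos
  have h4 := net.frame_pos
  have h5 := net.bwPenalty_pos
  unfold Network.linkRate
  rw [one_mul]
  refine mul_pos (by positivity) (Real.logb_pos (by norm_num) ?_)
  have := mul_pos h2 h1
  linarith

variable [Fintype N] {net} {σ : Schedule N}

theorem Network.Feasible.alloc_le_one (h : net.Feasible σ) (n m : N) : σ.alloc n m ≤ 1 :=
  (Finset.single_le_sum (f := fun m => σ.alloc n m) (fun i _ => h.nonneg n i)
    (Finset.mem_univ m)).trans (h.budget n)

theorem Network.Feasible.cap_eq_zero (h : net.Feasible σ) {n m : N} (hn : ¬ net.graph.Adj n m) :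
    net.cap σ n m = 0 := by
  rw [Network.cap, h.link n m hn, net.linkRate_zero]

theorem Network.Feasible.cap_nonneg (h : net.Feasible σ) (n m : N) : 0 ≤ net.cap σ n m := by
  by_cases hn : net.graph.Adj n m
  · rw [← net.linkRate_zero n m]
    exact net.linkRate_mono hn le_rfl (h.nonneg n m)
  · exact (h.cap_eq_zero hn).ge

theorem Network.Feasible.cap_le (h : net.Feasible σ) (n m : N) :
    net.cap σ n m ≤ |net.linkRate n m 1| := by
  by_cases hn : net.graph.Adj n m
  · exact (net.linkRate_mono hn (h.nonneg n m) (h.alloc_le_one n m)).trans (le_abs_self _)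
  · exact (h.cap_eq_zero hn).trans_le (abs_nonneg _)

/-- An upper bound on the sum of all link capacities under any schedule. -/
noncomputable def Network.totalRate (net : Network N F) : ℝ := ∑ n, ∑ m, |net.linkRate n m 1|

theorem Network.totalRate_nonneg (net : Network N F) : 0 ≤ net.totalRate :=
  Finset.sum_nonneg fun _ _ => Finset.sum_nonneg fun _ _ => abs_nonneg _

theorem Network.Feasible.sum_cap_out_le (h : net.Feasible σ) (n : N) :
    ∑ m, net.cap σ n m ≤ net.totalRate :=
  (Finset.sum_le_sum fun m _ => h.cap_le n m).trans
    (Finset.single_le_sum (f := fun n => ∑ m, |net.linkRate n m 1|)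
      (fun _ _ => Finset.sum_nonneg fun _ _ => abs_nonneg _) (Finset.mem_univ n))

theorem Network.Feasible.sum_cap_in_le (h : net.Feasible σ) (m : N) :
    ∑ n, net.cap σ n m ≤ net.totalRate :=
  Finset.sum_le_sum fun n _ => (h.cap_le n m).trans
    (Finset.single_le_sum (f := fun m => |net.linkRate n m 1|)
      (fun _ _ => abs_nonneg _) (Finset.mem_univ m))

/-- Removing links keeps a schedule feasible. -/
theorem Network.Feasible.restrict (h : net.Feasible σ) (P : N → N → Prop)
    [∀ n m, Decidable (P n m)] :
    net.Feasible ⟨σ.role, fun n m => if P n m then σ.alloc n m else 0⟩ where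
  nonneg n m := by dsimp only; split_ifs; exacts [h.nonneg n m, le_rfl]
  link n m hn := by simp [h.link n m hn]
  half_duplex n m := by
    dsimp only
    split_ifs
    exacts [h.half_duplex n m, (h.nonneg n m).trans (h.half_duplex n m)]
  budget n := by
    refine (Finset.sum_le_sum fun m _ => ?_).trans (h.budget n)
    dsimp only
    split_ifs
    exacts [le_rfl, h.nonneg n m]

/-- The schedule that gives the full power of `n` to its link to `m`. -/
theorem Network.feasible_single [DecidableEq N] (net : Network N F) {n m : N}
    (h : net.graph.Adj n m) :
    net.Feasible ⟨fun k => decide (k = n), fun k l => if k = n ∧ l = m then 1 else 0⟩ where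
  nonneg k l := by dsimp only; split_ifs <;> norm_num
  link k l hkl := if_neg (by rintro ⟨rfl, rfl⟩; exact hkl h)
  half_duplex k l := by
    dsimp only
    split_ifs with hk
    · obtain ⟨rfl, rfl⟩ := hk
      simp [h.ne']
    · by_cases h1 : k = n <;> by_cases h2 : l = n <;> simp [h1, h2]
  budget k := by
    by_cases hk : k = n <;> simp [hk]

/-- Up to a constant, the best total back pressure is that of full rates on all links with
positive queue differential. -/
theorem Network.sum_cap_mul_posPart_le [DecidableEq F] {q : N → F → ℝ} (hq : ∀ n f, 0 ≤ q n f)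
    {φ : N → N → F} {W : ℝ} (hW : ∀ τ, net.Feasible τ → net.mbpWeight q φ τ ≤ W)
    (h : net.Feasible σ) :
    ∑ n, ∑ m, net.cap σ n m * max (q n (φ n m) - q m (φ n m)) 0 ≤ W + net.totalRate ^ 2 := by
  classical
  -- The maximiser is compared with `σ` after switching off the links of nonpositive differential,
  -- which could only subtract back pressure; the other capacities are unchanged.
  set τ : Schedule N := ⟨σ.role, fun n m =>
    if 0 < q n (φ n m) - q m (φ n m) then σ.alloc n m else 0⟩ with hτ
  have hf : net.Feasible τ := h.restrict fun n m => 0 < q n (φ n m) - q m (φ n m)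
  have key : ∀ n m, net.cap σ n m * max (q n (φ n m) - q m (φ n m)) 0 ≤
      net.mbpRate q φ τ n m (φ n m) * (q n (φ n m) - q m (φ n m)) +
        |net.linkRate n m 1| * net.totalRate := by
    intro n m
    have hb : 0 ≤ |net.linkRate n m 1| * net.totalRate :=
      mul_nonneg (abs_nonneg _) net.totalRate_nonneg
    simp only [Network.mbpRate, if_true]
    by_cases hd : 0 < q n (φ n m) - q m (φ n m)
    · have hc : net.cap τ n m = net.cap σ n m := by
        simp only [Network.cap, hτ, if_pos hd]
      rw [max_eq_left hd.le, ← hc]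
      set S := ∑ m' with φ n m' = φ n m, net.cap τ n m' with hS
      have hcS : net.cap τ n m ≤ S :=
        Finset.single_le_sum (f := fun m => net.cap τ n m) (fun i _ => hf.cap_nonneg n i)
          (by simp)
      have hST : S ≤ net.totalRate :=
        (Finset.sum_le_sum_of_subset_of_nonneg (Finset.subset_univ _)
          fun i _ _ => hf.cap_nonneg n i).trans (hf.sum_cap_out_le n)
      have h0 := hf.cap_nonneg n m
      have hsh : 0 ≤ net.share φ τ n m := div_nonneg h0 (h0.trans hcS)
      -- If the queue holds at least `S`, its limit does not bind and the full capacity is used.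
      -- Otherwise the differential is at most the queue, hence at most `totalRate`, and the whole
      -- term is absorbed in the error.
      rcases le_total S (q n (φ n m)) with hle | hle
      · have : net.cap τ n m ≤ q n (φ n m) * net.share φ τ n m := by
          rcases (h0.trans hcS).eq_or_lt with h1 | h1
          · exact (hcS.trans h1.ge).trans (mul_nonneg (hq _ _) hsh)
          · rw [Network.share, ← hS, ← mul_div_assoc, le_div_iff₀ h1, mul_comm]
            exact mul_le_mul_of_nonneg_right hle h0
        rw [min_eq_left this]
        linarith
      · have h1 : 0 ≤ min (net.cap τ n m) (q n (φ n m) * net.share φ τ n m) :=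
          le_min h0 (mul_nonneg (hq _ _) hsh)
        have h2 : net.cap τ n m * (q n (φ n m) - q m (φ n m)) ≤
            |net.linkRate n m 1| * net.totalRate :=
          mul_le_mul (hf.cap_le n m) (by linarith [hq m (φ n m)]) hd.le (abs_nonneg _)
        have := mul_nonneg h1 hd.le
        linarith
    · have hc : net.cap τ n m = 0 := by
        simp only [Network.cap, hτ, if_neg hd, net.linkRate_zero]
      rw [max_eq_right (not_lt.1 hd), Network.share, hc]
      simpa using hb
  calc _ ≤ ∑ n, ∑ m, (net.mbpRate q φ τ n m (φ n m) * (q n (φ n m) - q m (φ n m)) +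
        |net.linkRate n m 1| * net.totalRate) :=
        Finset.sum_le_sum fun n _ => Finset.sum_le_sum fun m _ => key n m
    _ = net.mbpWeight q φ τ + net.totalRate ^ 2 := by
        simp_rw [Finset.sum_add_distrib, ← Finset.sum_mul]
        rw [Network.mbpWeight, sq, Network.totalRate]
    _ ≤ _ := by linarith [hW τ hf]

/-- The schedule serving a single link at full power is among the competitors, so the optimum
controls each differential separately. -/
theorem Network.linkRate_mul_sub_le [DecidableEq N] {q : N → F → ℝ} {φ : N → N → F} {W : ℝ}
    (hφ : ∀ n m f, q n f - q m f ≤ q n (φ n m) - q m (φ n m))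
    (hW : ∀ σ, net.Feasible σ → ∑ n, ∑ m, net.cap σ n m * max (q n (φ n m) - q m (φ n m)) 0 ≤ W)
    {n m : N} (h : net.graph.Adj n m) (f : F) :
    net.linkRate n m 1 * (q n f - q m f) ≤ W := by
  have hs := net.feasible_single h
  refine le_trans ?_ (hW _ hs)
  set σ : Schedule N := ⟨fun k => decide (k = n), fun k l => if k = n ∧ l = m then 1 else 0⟩
  have h0 : ∀ k l, 0 ≤ net.cap σ k l * max (q k (φ k l) - q l (φ k l)) 0 := fun k l =>
    mul_nonneg (hs.cap_nonneg k l) (le_max_right _ _)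
  have h1 : net.cap σ n m = net.linkRate n m 1 := by simp [Network.cap, σ]
  calc _ ≤ net.cap σ n m * max (q n (φ n m) - q m (φ n m)) 0 := by
        rw [h1]
        exact mul_le_mul_of_nonneg_left ((hφ n m f).trans (le_max_left _ _))
          (net.linkRate_one_pos h).le
    _ ≤ ∑ l, net.cap σ n l * max (q n (φ n l) - q l (φ n l)) 0 :=
        Finset.single_le_sum (f := fun l => net.cap σ n l * max (q n (φ n l) - q l (φ n l)) 0)
          (fun l _ => h0 n l) (Finset.mem_univ m)
    _ ≤ _ := Finset.single_le_sum
          (f := fun k => ∑ l, net.cap σ k l * max (q k (φ k l) - q l (φ k l)) 0)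
          (fun k _ => Finset.sum_nonneg fun l _ => h0 k l) (Finset.mem_univ n)

omit [Fintype N] in
/-- If every queue differential is at most `W` over the full rate of the link, then a queue with a
path to a zero queue is at most a constant times `W`. -/
theorem Network.exists_queue_le_of_reachable (net : Network N F) {n d : N}
    (h : net.graph.Reachable n d) :
    ∃ κ : ℝ, 0 ≤ κ ∧ ∀ (v : N → ℝ) (W : ℝ), v d = 0 →
      (∀ k l, net.graph.Adj k l → net.linkRate k l 1 * (v k - v l) ≤ W) → v n ≤ κ * W := by
  obtain ⟨p⟩ := h
  induction p with
  | nil => exact ⟨0, le_rfl, fun v W h0 _ => by simp [h0]⟩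
  | cons hadj p ih =>
    rename_i u w z
    obtain ⟨κ, hκ, H⟩ := ih
    have hr := net.linkRate_one_pos hadj
    refine ⟨κ + (net.linkRate u w 1)⁻¹, by positivity, fun v W h0 hW => ?_⟩
    have h1 := H v W h0 hW
    have h2 : v u - v w ≤ W / net.linkRate u w 1 := by
      rw [le_div_iff₀ hr, mul_comm]; exact hW _ _ hadj
    rw [add_mul, inv_mul_eq_div]
    linarith

end Rates

/-! ### A law of large numbers for bounded orthogonal variables. -/

section Averages

variable {Ω : Type*} [MeasurableSpace Ω] {μ : Measure Ω} [IsProbabilityMeasure μ]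

theorem integral_sq_sum_le_of_orthogonal {D : ℕ → Ω → ℝ} (hm : ∀ t, Measurable (D t)) {K : ℝ}
    (hK : ∀ t ω, |D t ω| ≤ K) (ho : ∀ s t, s < t → ∫ ω, D s ω * D t ω ∂μ = 0) (T : ℕ) :
    ∫ ω, (∑ t ∈ Finset.range T, D t ω) ^ 2 ∂μ ≤ T * K ^ 2 := by
  have hint : ∀ s t, Integrable (fun ω => D s ω * D t ω) μ := fun s t =>
    Integrable.of_bound ((hm s).mul (hm t)).aestronglyMeasurable (K * K)
      (ae_of_all _ fun ω => by
        rw [Real.norm_eq_abs, abs_mul]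
        exact mul_le_mul (hK s ω) (hK t ω) (abs_nonneg _) ((abs_nonneg _).trans (hK s ω)))
  induction T with
  | zero => simp
  | succ T ih =>
    have hsq : Integrable (fun ω => (∑ t ∈ Finset.range T, D t ω) ^ 2) μ := by
      simp_rw [sq, Finset.sum_mul_sum]
      exact integrable_finsetSum _ fun i _ => integrable_finsetSum _ fun j _ => hint i j
    have hcr : Integrable (fun ω => ∑ t ∈ Finset.range T, D t ω * D T ω) μ :=
      integrable_finsetSum _ fun i _ => hint i T
    have e : ∀ ω, (∑ t ∈ Finset.range (T + 1), D t ω) ^ 2 =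
        (∑ t ∈ Finset.range T, D t ω) ^ 2 + 2 * (∑ t ∈ Finset.range T, D t ω * D T ω) +
          D T ω * D T ω := fun ω => by
      rw [Finset.sum_range_succ, ← Finset.sum_mul]; ring
    have hsc : Integrable (fun ω => (∑ t ∈ Finset.range T, D t ω) ^ 2 +
        2 * ∑ t ∈ Finset.range T, D t ω * D T ω) μ := hsq.add (hcr.const_mul 2)
    simp_rw [e]
    rw [integral_add hsc (hint T T), integral_add hsq (hcr.const_mul 2),
      integral_const_mul, integral_finsetSum _ fun i _ => hint i T,
      Finset.sum_eq_zero fun i hi => ho i T (Finset.mem_range.1 hi)]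
    have h2 : ∫ ω, D T ω * D T ω ∂μ ≤ K ^ 2 := by
      calc _ ≤ ∫ _, K ^ 2 ∂μ := by
            refine integral_mono (hint T T) (integrable_const _) fun ω => ?_
            dsimp only
            rw [← sq, ← sq_abs]
            exact pow_le_pow_left₀ (abs_nonneg _) (hK T ω) 2
        _ = K ^ 2 := by simp
    push_cast
    linarith

/-- Strong law of large numbers for bounded orthogonal random variables. -/
theorem ae_tendsto_average_of_orthogonal {D : ℕ → Ω → ℝ} (hm : ∀ t, Measurable (D t)) {K : ℝ}
    (hK : ∀ t ω, |D t ω| ≤ K) (ho : ∀ s t, s < t → ∫ ω, D s ω * D t ω ∂μ = 0) :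
    ∀ᵐ ω ∂μ, Tendsto (fun T : ℕ => (∑ t ∈ Finset.range T, D t ω) / T) atTop (nhds 0) := by
  set S : ℕ → Ω → ℝ := fun T ω => ∑ t ∈ Finset.range T, D t ω with hS
  set c : ℕ → ℕ := fun k => (k + 1) ^ 2 with hc
  have hSm : ∀ T, Measurable (S T) := fun T => Finset.measurable_fun_sum _ fun t _ => hm t
  have hSb : ∀ T ω, |S T ω| ≤ T * K := fun T ω =>
    (Finset.abs_sum_le_sum_abs _ _).trans
      ((Finset.sum_le_sum fun t _ => hK t ω).trans (by simp))
  have hK0 : 0 ≤ K ^ 2 := sq_nonneg K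
  -- Along the squares, the second moments of the averages are summable; hence these averages tend
  -- to zero almost surely.
  have hlin : ∀ k, ∫⁻ ω, ENNReal.ofReal ((S (c k) ω / c k) ^ 2) ∂μ ≤
      ENNReal.ofReal (K ^ 2 * (1 / ((k + 1 : ℕ) : ℝ) ^ 2)) := by
    intro k
    have hc0 : (0 : ℝ) < c k := by simp only [hc]; positivity
    have hi : Integrable (fun ω => (S (c k) ω / c k) ^ 2) μ := by
      refine Integrable.of_bound (((hSm _).div_const _).pow_const 2).aestronglyMeasurable (K ^ 2)
        (ae_of_all _ fun ω => ?_)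
      rw [Real.norm_eq_abs, abs_pow, abs_div, abs_of_pos hc0]
      refine pow_le_pow_left₀ (by positivity) ?_ 2
      rw [div_le_iff₀ hc0, mul_comm]
      exact hSb _ ω
    rw [← ofReal_integral_eq_lintegral_ofReal hi (ae_of_all _ fun ω => sq_nonneg _)]
    refine ENNReal.ofReal_le_ofReal ?_
    simp_rw [div_pow]
    rw [integral_div, div_le_iff₀ (by positivity)]
    refine (integral_sq_sum_le_of_orthogonal hm hK ho (c k)).trans (le_of_eq ?_)
    simp only [hc]
    push_cast
    field_simp
  have hsum : Summable fun k : ℕ => K ^ 2 * (1 / ((k + 1 : ℕ) : ℝ) ^ 2) :=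
    ((summable_nat_add_iff 1).2 (Real.summable_one_div_nat_pow.2 one_lt_two)).mul_left _
  have hfin : ∫⁻ ω, ∑' k, ENNReal.ofReal ((S (c k) ω / c k) ^ 2) ∂μ ≠ ⊤ := by
    rw [lintegral_tsum fun k => (((hSm _).div_const _).pow_const 2).ennreal_ofReal.aemeasurable]
    refine ne_top_of_le_ne_top ?_ (ENNReal.tsum_le_tsum hlin)
    rw [← ENNReal.ofReal_tsum_of_nonneg (fun k => by positivity) hsum]
    exact ENNReal.ofReal_ne_top
  have hae := ae_lt_top' (AEMeasurable.tsum fun k =>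
    (((hSm (c k)).div_const (c k : ℝ)).pow_const 2).ennreal_ofReal.aemeasurable) hfin
  filter_upwards [hae] with ω hω
  have h1 : Tendsto (fun k => S (c k) ω / c k) atTop (nhds 0) := by
    have h2 := ENNReal.tendsto_atTop_zero_of_tsum_ne_top hω.ne
    have h3 := (ENNReal.tendsto_toReal ENNReal.zero_ne_top).comp h2
    have h4 : Tendsto (fun k => (S (c k) ω / c k) ^ 2) atTop (nhds 0) := by
      refine h3.congr fun k => ?_
      simp [ENNReal.toReal_ofReal (sq_nonneg _)]
    have h5 := h4.sqrt
    simp_rw [Real.sqrt_sq_eq_abs, Real.sqrt_zero] at h5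
    exact (tendsto_zero_iff_abs_tendsto_zero _).2 h5
  -- Adding `T * K` makes the partial sums monotone, since `D ≥ -K`. As ratios of consecutive
  -- squares tend to 1, convergence along the squares extends to all `T`.
  have hmain : Tendsto (fun T : ℕ => (S T ω + T * K) / T) atTop (nhds K) := by
    refine tendsto_div_of_monotone_of_exists_subseq_tendsto_div (fun T => S T ω + T * K) K
      (monotone_nat_of_le_succ fun T => ?_) fun b hb => ⟨c, ?_, ?_, ?_⟩
    · simp only [hS, Finset.sum_range_succ]
      push_cast
      linarith [neg_abs_le (D T ω), hK T ω]
    · have : Tendsto (fun k : ℕ => (1 + 1 / ((k : ℝ) + 1)) ^ 2) atTop (nhds ((1 + 0) ^ 2)) :=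
        (tendsto_const_nhds.add tendsto_one_div_add_atTop_nhds_zero_nat).pow 2
      filter_upwards [this.eventually_lt_const (show (1 + 0 : ℝ) ^ 2 < b by simpa using hb)] with k hk
      simp only [hc]
      push_cast
      have h0 : (0 : ℝ) < (k : ℝ) + 1 := by positivity
      calc ((k : ℝ) + 1 + 1) ^ 2 = (1 + 1 / ((k : ℝ) + 1)) ^ 2 * (k + 1) ^ 2 := by field_simp
        _ ≤ _ := by gcongr
    · exact tendsto_atTop_mono (fun k => (Nat.le_succ k).trans (Nat.le_self_pow two_ne_zero _)) tendsto_id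
    · have := h1.add_const K
      rw [zero_add] at this
      refine this.congr fun k => ?_
      have hc0 : (c k : ℝ) ≠ 0 := by simp only [hc]; positivity
      field_simp
  have := hmain.sub_const K
  rw [sub_self] at this
  refine this.congr' ?_
  filter_upwards [eventually_gt_atTop 0] with T hT
  have : (T : ℝ) ≠ 0 := by positivity
  field_simp
  ring

end Averages

/-! ### Queue dynamics and the outer bound on the capacity region. -/

section Operation

variable {N F : Type*} [Fintype N] [DecidableEq N] [Fintype F] {net : Network N F} {Ω : Type*}
  [MeasurableSpace Ω] {μ : Measure Ω} {x : N → F → ℝ}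

omit [DecidableEq N] in
-- Summation by parts on the network: a transfer from `n` to `m` changes the weighted sum by the
-- difference of the weights.
theorem sum_mul_netInflow (v : N → F → ℝ) (c : N → N → F → ℝ) :
    ∑ n, ∑ f, v n f * ∑ m, (c m n f - c n m f) =
      -∑ n, ∑ m, ∑ f, c n m f * (v n f - v m f) := by
  have h1 : ∑ n, ∑ f, ∑ m, v n f * c m n f = ∑ n, ∑ m, ∑ f, c n m f * v m f := by
    rw [Finset.sum_comm' (t' := Finset.univ) (s' := fun _ => Finset.univ) (by simp)]
    rw [Finset.sum_comm]
    simp_rw [Finset.sum_comm (s := (Finset.univ : Finset F)) (t := (Finset.univ : Finset N))]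
    rw [Finset.sum_comm]
    simp_rw [mul_comm]
  have h2 : ∑ n, ∑ f, ∑ m, v n f * c n m f = ∑ n, ∑ m, ∑ f, c n m f * v n f := by
    refine Finset.sum_congr rfl fun n _ => ?_
    rw [Finset.sum_comm]
    simp_rw [mul_comm]
  simp_rw [Finset.mul_sum, mul_sub, Finset.sum_sub_distrib]
  rw [h1, h2]
  ring

namespace Operation

variable (R : Operation net μ x)

theorem q_dest (t : ℕ) (ω : Ω) {n : N} {f : F} (h : n ∈ net.dest f) : R.q t ω n f = 0 := by
  cases t with
  | zero => rw [R.q_zero, R.q₀_dest n f h]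
  | succ t => rw [R.q_succ, if_pos h]

theorem q_nonneg (t : ℕ) (ω : Ω) (n : N) (f : F) : 0 ≤ R.q t ω n f := by
  cases t with
  | zero => rw [R.q_zero]; exact R.q₀_nonneg n f
  | succ t =>
    rw [R.q_succ]
    split_ifs
    · exact le_rfl
    · have h1 := R.c_le_queue t ω n f
      have h2 := R.a_nonneg t ω n f
      have h3 : 0 ≤ ∑ m, R.c t ω m n f := Finset.sum_nonneg fun m _ => R.c_nonneg _ _ _ _ _
      rw [Finset.sum_sub_distrib]
      linarith

theorem c_le_cap_single (t : ℕ) (ω : Ω) (n m : N) (f : F) :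
    R.c t ω n m f ≤ net.cap (R.σ t ω) n m :=
  (Finset.single_le_sum (f := fun f => R.c t ω n m f) (fun _ _ => R.c_nonneg _ _ _ _ _)
    (Finset.mem_univ f)).trans (R.c_le_cap t ω n m)

theorem c_eq_zero (t : ℕ) (ω : Ω) {n m : N} (h : ¬ net.graph.Adj n m) (f : F) :
    R.c t ω n m f = 0 :=
  le_antisymm ((R.c_le_cap_single t ω n m f).trans ((R.feasible t ω).cap_eq_zero h).le)
    (R.c_nonneg _ _ _ _ _)

theorem abs_netInflow_le (t : ℕ) (ω : Ω) (n : N) (f : F) :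
    |∑ m, (R.c t ω m n f - R.c t ω n m f)| ≤ net.totalRate := by
  have h1 : ∑ m, R.c t ω m n f ≤ net.totalRate :=
    (Finset.sum_le_sum fun m _ => R.c_le_cap_single t ω m n f).trans
      ((R.feasible t ω).sum_cap_in_le n)
  have h2 : ∑ m, R.c t ω n m f ≤ net.totalRate :=
    (Finset.sum_le_sum fun m _ => R.c_le_cap_single t ω n m f).trans
      ((R.feasible t ω).sum_cap_out_le n)
  have h3 : 0 ≤ ∑ m, R.c t ω m n f := Finset.sum_nonneg fun m _ => R.c_nonneg _ _ _ _ _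
  have h4 : 0 ≤ ∑ m, R.c t ω n m f := Finset.sum_nonneg fun m _ => R.c_nonneg _ _ _ _ _
  rw [Finset.sum_sub_distrib, abs_le]
  constructor <;> linarith

/-- Evolution of a weighted sum of the queues whose weights vanish at the destinations. -/
theorem sum_mul_q_succ {w : N → F → ℝ} (hw : ∀ n f, n ∈ net.dest f → w n f = 0) (t : ℕ) (ω : Ω) :
    ∑ n, ∑ f, w n f * R.q (t + 1) ω n f = ∑ n, ∑ f, w n f * R.q t ω n f -
      ∑ n, ∑ m, ∑ f, R.c t ω n m f * (w n f - w m f) + ∑ n, ∑ f, w n f * R.a t ω n f := by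
  rw [sub_eq_add_neg, ← sum_mul_netInflow]
  simp_rw [← Finset.sum_add_distrib]
  refine Finset.sum_congr rfl fun n _ => Finset.sum_congr rfl fun f _ => ?_
  rw [R.q_succ]
  split_ifs with h
  · simp [hw n f h]
  · ring

/-- In each frame, transfers remove at most `M` of weighted queue, whatever the policy; what has
arrived beyond that is still there. -/
theorem sum_mul_q_ge {w : N → F → ℝ} (hw0 : ∀ n f, 0 ≤ w n f)
    (hw : ∀ n f, n ∈ net.dest f → w n f = 0) {D : N → N → ℝ} (hD0 : ∀ n m, 0 ≤ D n m)
    (hD : ∀ n m f, w n f - w m f ≤ D n m) {M : ℝ}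
    (hM : ∀ σ, net.Feasible σ → ∑ n, ∑ m, net.cap σ n m * D n m ≤ M) (T : ℕ) (ω : Ω) :
    ∑ t ∈ Finset.range T, ∑ n, ∑ f, w n f * R.a t ω n f - T * M ≤
      ∑ n, ∑ f, w n f * R.q T ω n f := by
  induction T with
  | zero =>
    simpa using Finset.sum_nonneg fun n _ => Finset.sum_nonneg fun f _ =>
      mul_nonneg (hw0 n f) (R.q_nonneg 0 ω n f)
  | succ T ih =>
    have h : ∑ n, ∑ m, ∑ f, R.c T ω n m f * (w n f - w m f) ≤ M := by
      refine le_trans ?_ (hM _ (R.feasible T ω))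
      refine Finset.sum_le_sum fun n _ => Finset.sum_le_sum fun m _ => ?_
      calc _ ≤ ∑ f, R.c T ω n m f * D n m := Finset.sum_le_sum fun f _ =>
            mul_le_mul_of_nonneg_left (hD n m f) (R.c_nonneg _ _ _ _ _)
        _ ≤ _ := by
            rw [← Finset.sum_mul]
            exact mul_le_mul_of_nonneg_right (R.c_le_cap T ω n m) (hD0 n m)
    rw [R.sum_mul_q_succ hw, Finset.sum_range_succ]
    push_cast
    linarith

theorem a_measurable' (t : ℕ) : Measurable (R.a t) :=
  (R.a_measurable t).mono (R.ℱ.le _) le_rfl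

theorem a_indepFun (t : ℕ) {β : Type*} [MeasurableSpace β] {Y : Ω → β}
    (hY : Measurable[R.ℱ t] Y) : IndepFun (R.a t) Y μ := by
  rw [IndepFun_iff_Indep]
  exact indep_of_indep_of_le_right (R.a_indep t) hY.comap_le

/-- Strong law of large numbers for functions of the arrivals. -/
theorem ae_tendsto_average (g : (N → F → ℝ) → ℝ) (hg : Measurable g)
    (hi : Integrable (fun ω => g (R.a 0 ω)) μ) :
    ∀ᵐ ω ∂μ, Tendsto (fun T : ℕ => (∑ t ∈ Finset.range T, g (R.a t ω)) / T) atTop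
      (nhds (∫ ω, g (R.a 0 ω) ∂μ)) := by
  have hind : ∀ s t, s < t → IndepFun (fun ω => g (R.a t ω)) (fun ω => g (R.a s ω)) μ := by
    intro s t hst
    exact (R.a_indepFun t ((R.a_measurable s).mono (R.ℱ.mono hst) le_rfl)).comp hg hg
  refine strong_law_ae_real (fun t ω => g (R.a t ω)) hi (fun s t hst => ?_)
    fun t => (R.a_identDistrib t).comp hg
  rcases hst.lt_or_gt with h | h
  exacts [(hind s t h).symm, hind t s h]

theorem q_measurable (t : ℕ) : Measurable[R.ℱ t] (R.q t) := by
  induction t with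
  | zero =>
    rw [show R.q 0 = fun _ => R.q₀ from funext R.q_zero]
    exact measurable_const
  | succ t ih =>
    have hq : Measurable[R.ℱ (t + 1)] (R.q t) := ih.mono (R.ℱ.mono (Nat.le_succ t)) le_rfl
    have hc : Measurable[R.ℱ (t + 1)] (R.c t) :=
      (R.c_measurable t).mono (R.ℱ.mono (Nat.le_succ t)) le_rfl
    have ha := R.a_measurable t
    have e : R.q (t + 1) = fun ω n f => if n ∈ net.dest f then 0
      else R.q t ω n f + ∑ m, (R.c t ω m n f - R.c t ω n m f) + R.a t ω n f := by
      funext ω n f; exact R.q_succ t ω n f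
    rw [e]
    refine @measurable_pi_lambda _ _ _ (R.ℱ (t + 1)) _ _ fun n =>
      @measurable_pi_lambda _ _ _ (R.ℱ (t + 1)) _ _ fun f => ?_
    split_ifs
    · exact measurable_const
    · have hq' : Measurable[R.ℱ (t + 1)] fun ω => R.q t ω n f :=
        (measurable_pi_apply f).comp ((measurable_pi_apply n).comp hq)
      have ha' : Measurable[R.ℱ (t + 1)] fun ω => R.a t ω n f :=
        (measurable_pi_apply f).comp ((measurable_pi_apply n).comp ha)
      have hc' : ∀ k l, Measurable[R.ℱ (t + 1)] fun ω => R.c t ω k l f := fun k l =>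
        (measurable_pi_apply f).comp ((measurable_pi_apply l).comp
          ((measurable_pi_apply k).comp hc))
      exact (hq'.add (Finset.measurable_fun_sum _ fun m _ => (hc' m n).sub (hc' n m))).add ha'

end Operation

/-- A rate vector in the capacity region, weighted with `w`, is at most the largest total weight
of a schedule. -/
theorem Network.sum_mul_le_of_mem_capacityRegion {y : N → F → ℝ} (hy : y ∈ net.capacityRegion)
    {w : N → F → ℝ} (hw0 : ∀ n f, 0 ≤ w n f) (hw : ∀ n f, n ∈ net.dest f → w n f = 0)
    {D : N → N → ℝ} (hD0 : ∀ n m, 0 ≤ D n m) (hD : ∀ n m f, w n f - w m f ≤ D n m) {M : ℝ}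
    (hM : ∀ σ, net.Feasible σ → ∑ n, ∑ m, net.cap σ n m * D n m ≤ M) :
    ∑ n, ∑ f, w n f * y n f ≤ M := by
  obtain ⟨Ω, _, μ, _, R, hR⟩ := hy
  have hmeas : Measurable fun a : N → F → ℝ => ∑ n, ∑ f, w n f * a n f := by fun_prop
  have hint : ∀ n, Integrable (fun ω => ∑ f, w n f * R.a 0 ω n f) μ := fun n =>
    integrable_finsetSum _ fun f _ => (R.a_integrable 0 n f).const_mul _
  have hmean : ∫ ω, ∑ n, ∑ f, w n f * R.a 0 ω n f ∂μ = ∑ n, ∑ f, w n f * y n f := by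
    rw [integral_finsetSum _ fun n _ => hint n]
    refine Finset.sum_congr rfl fun n _ => ?_
    rw [integral_finsetSum _ fun f _ => (R.a_integrable 0 n f).const_mul _]
    exact Finset.sum_congr rfl fun f _ => by rw [integral_const_mul, R.a_mean]
  have hlln := R.ae_tendsto_average _ hmeas (integrable_finsetSum _ fun n _ => hint n)
  rw [hmean] at hlln
  obtain ⟨ω, hω, hst⟩ := (hlln.and hR).exists
  obtain ⟨B, hB⟩ := hst (1 / 2) (by norm_num)
  by_contra! hlt
  set y' := ∑ n, ∑ f, w n f * y n f with hy'
  set A := ∑ n, ∑ f, w n f with hA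
  have hA0 : 0 ≤ A := Finset.sum_nonneg fun n _ => Finset.sum_nonneg fun f _ => hw0 n f
  have hwA : ∀ n f, w n f ≤ A := fun n f =>
    (Finset.single_le_sum (f := fun f => w n f) (fun f _ => hw0 n f) (Finset.mem_univ f)).trans
      (Finset.single_le_sum (f := fun n => ∑ f, w n f)
        (fun n _ => Finset.sum_nonneg fun f _ => hw0 n f) (Finset.mem_univ n))
  obtain ⟨z, hz1, hz2⟩ := exists_between hlt
  -- If `w · y > M`, the weighted queue eventually exceeds `(z - M) T` with `z > M`, so the total
  -- queue passes every level for good.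
  have hbig : ∀ᶠ T : ℕ in atTop, B < ∑ n, ∑ f, R.q T ω n f := by
    have hlarge : ∀ᶠ T : ℕ in atTop, A * |B| < (z - M) * T :=
      (tendsto_natCast_atTop_atTop.const_mul_atTop (sub_pos.2 hz1)).eventually_gt_atTop _
    filter_upwards [hω.eventually (lt_mem_nhds hz2), hlarge, eventually_gt_atTop 0]
      with T hT1 hT2 hT3
    have hT0 : (0 : ℝ) < T := by exact_mod_cast hT3
    rw [lt_div_iff₀ hT0] at hT1
    have h1 := R.sum_mul_q_ge hw0 hw hD0 hD hM T ω
    have h2 : ∑ n, ∑ f, w n f * R.q T ω n f ≤ A * ∑ n, ∑ f, R.q T ω n f := by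
      simp_rw [Finset.mul_sum]
      exact Finset.sum_le_sum fun n _ => Finset.sum_le_sum fun f _ =>
        mul_le_mul_of_nonneg_right (hwA n f) (R.q_nonneg T ω n f)
    have h3 : A * |B| < A * ∑ n, ∑ f, R.q T ω n f := by linarith
    exact (le_abs_self B).trans_lt (lt_of_mul_lt_mul_left h3 hA0)
  obtain ⟨T₀, hT₀⟩ := eventually_atTop.1 hbig
  -- After `2 * T₀` frames, more than half of the frames lie above `B`, against stability with
  -- fraction `1 / 2`.
  obtain ⟨T, hT1, hT2⟩ := (hB.and (eventually_gt_atTop (2 * T₀))).exists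
  have hsub : Finset.Ico T₀ T ⊆ {t ∈ Finset.range T | B < ∑ n, ∑ f, R.q t ω n f} := by
    intro t ht
    rw [Finset.mem_Ico] at ht
    exact Finset.mem_filter.2 ⟨Finset.mem_range.2 ht.2, hT₀ t ht.1⟩
  have hcard := Finset.card_le_card hsub
  rw [Nat.card_Ico] at hcard
  have h1 : (T : ℝ) - T₀ ≤ 1 / 2 * T := by
    refine le_trans ?_ hT1
    rw [sub_le_iff_le_add]
    exact_mod_cast Nat.sub_le_iff_le_add.1 hcard
  have h2 : (2 * T₀ : ℝ) < T := by exact_mod_cast hT2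
  linarith

end Operation

/-! ### Increments of the smoothed Euclidean norm. -/

section Potential

variable {ι : Type*} [Fintype ι]

/-- A nonnegative perturbation costs only its `ℓ¹` norm. Excess arrivals, whose second moment may be
infinite, are charged this way. -/
theorem sqrt_add_sum_sq_add_le (p r : ι → ℝ) (hr : ∀ i, 0 ≤ r i) (B : ℝ) :
    √(B ^ 2 + ∑ i, (p i + r i) ^ 2) ≤ √(B ^ 2 + ∑ i, p i ^ 2) + ∑ i, r i := by
  set s := √(B ^ 2 + ∑ i, p i ^ 2) with hs
  have hsum : 0 ≤ ∑ i, p i ^ 2 := Finset.sum_nonneg fun i _ => sq_nonneg (p i)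
  have hs2 : s ^ 2 = B ^ 2 + ∑ i, p i ^ 2 := Real.sq_sqrt (by positivity)
  have hρ : 0 ≤ ∑ i, r i := Finset.sum_nonneg fun i _ => hr i
  have hp : ∀ i, p i ≤ s := fun i => Real.le_sqrt_of_sq_le (by
    have := Finset.single_le_sum (f := fun i => p i ^ 2) (fun i _ => sq_nonneg (p i))
      (Finset.mem_univ i)
    nlinarith [sq_nonneg B])
  have h1 : ∑ i, p i * r i ≤ s * ∑ i, r i := by
    rw [Finset.mul_sum]
    exact Finset.sum_le_sum fun i _ => mul_le_mul_of_nonneg_right (hp i) (hr i)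
  have h2 : ∑ i, r i ^ 2 ≤ (∑ i, r i) ^ 2 := Finset.sum_sq_le_sq_sum_of_nonneg fun i _ => hr i
  refine Real.sqrt_le_iff.2 ⟨by positivity, ?_⟩
  have e : ∑ i, (p i + r i) ^ 2 = ∑ i, p i ^ 2 + 2 * ∑ i, p i * r i + ∑ i, r i ^ 2 := by
    rw [Finset.mul_sum, ← Finset.sum_add_distrib, ← Finset.sum_add_distrib]
    exact Finset.sum_congr rfl fun i _ => by ring
  rw [e]
  nlinarith

/-- The bounded part `v` is expanded by the tangent of the square root at `s²`, in the form `2ab ≤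
a² + b²`. Since `s ≥ B`, the quadratic remainder becomes small for large `B`. -/
theorem sqrt_add_sum_sq_add_add_le (q v r : ι → ℝ) (hr : ∀ i, 0 ≤ r i) {B : ℝ} (hB : 0 < B) :
    √(B ^ 2 + ∑ i, (q i + v i + r i) ^ 2) ≤ √(B ^ 2 + ∑ i, q i ^ 2) +
      (∑ i, q i * v i) / √(B ^ 2 + ∑ i, q i ^ 2) + (∑ i, v i ^ 2) / (2 * B) + ∑ i, r i := by
  refine (sqrt_add_sum_sq_add_le (fun i => q i + v i) r hr B).trans ?_
  set s := √(B ^ 2 + ∑ i, q i ^ 2) with hs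
  have hsum : 0 ≤ ∑ i, q i ^ 2 := Finset.sum_nonneg fun i _ => sq_nonneg (q i)
  have hsum' : 0 ≤ ∑ i, (q i + v i) ^ 2 := Finset.sum_nonneg fun i _ => sq_nonneg _
  have hv : 0 ≤ ∑ i, v i ^ 2 := Finset.sum_nonneg fun i _ => sq_nonneg (v i)
  have hs2 : s ^ 2 = B ^ 2 + ∑ i, q i ^ 2 := Real.sq_sqrt (by positivity)
  have hBs : B ≤ s := Real.le_sqrt_of_sq_le (by linarith)
  have hs0 : 0 < s := hB.trans_le hBs
  have e : ∑ i, (q i + v i) ^ 2 = ∑ i, q i ^ 2 + 2 * ∑ i, q i * v i + ∑ i, v i ^ 2 := by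
    rw [Finset.mul_sum, ← Finset.sum_add_distrib, ← Finset.sum_add_distrib]
    exact Finset.sum_congr rfl fun i _ => by ring
  have h1 : √(B ^ 2 + ∑ i, (q i + v i) ^ 2) ≤
      s + (∑ i, q i * v i) / s + (∑ i, v i ^ 2) / (2 * s) := by
    have h2 := two_mul_le_add_sq (√(B ^ 2 + ∑ i, (q i + v i) ^ 2)) s
    rw [Real.sq_sqrt (by positivity), e] at h2
    have h3 : s + (∑ i, q i * v i) / s + (∑ i, v i ^ 2) / (2 * s) =
        (2 * s ^ 2 + 2 * ∑ i, q i * v i + ∑ i, v i ^ 2) / (2 * s) := by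
      field_simp
    rw [h3, le_div_iff₀ (by positivity)]
    rw [e]
    linarith
  have h4 : (∑ i, v i ^ 2) / (2 * s) ≤ (∑ i, v i ^ 2) / (2 * B) :=
    div_le_div_of_nonneg_left hv (by positivity) (by linarith)
  linarith

end Potential

/-! ### Unreachable destinations and the drift of Maximum Back Pressure. -/

section MBP

variable {N F : Type*}

/-- No destination of flow `f` can be reached from `n`. -/
def Network.Stranded (net : Network N F) (n : N) (f : F) : Prop :=
  ∀ d ∈ net.dest f, ¬ net.graph.Reachable n d

theorem Network.stranded_congr (net : Network N F) {n m : N} (h : net.graph.Adj n m) (f : F) :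
    net.Stranded n f ↔ net.Stranded m f :=
  forall₂_congr fun _ _ => not_congr
    ⟨fun hn => h.symm.reachable.trans hn, fun hm => h.reachable.trans hm⟩

open Classical in
/-- Indicator of the pairs `(n, f)` from which no destination can be reached. -/
noncomputable def Network.strandedInd (net : Network N F) (n : N) (f : F) : ℝ :=
  if net.Stranded n f then 1 else 0

theorem Network.strandedInd_nonneg (net : Network N F) (n : N) (f : F) :
    0 ≤ net.strandedInd n f := by
  unfold Network.strandedInd; split_ifs <;> norm_num

theorem Network.strandedInd_le_one (net : Network N F) (n : N) (f : F) :
    net.strandedInd n f ≤ 1 := by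
  unfold Network.strandedInd; split_ifs <;> norm_num

theorem Network.strandedInd_dest (net : Network N F) (n : N) (f : F) (h : n ∈ net.dest f) :
    net.strandedInd n f = 0 :=
  if_neg fun hn => hn n h (SimpleGraph.Reachable.refl n)

theorem Network.strandedInd_congr (net : Network N F) {n m : N} (h : net.graph.Adj n m) (f : F) :
    net.strandedInd n f = net.strandedInd m f := by
  unfold Network.strandedInd
  rw [propext (net.stranded_congr h f)]

variable [Fintype N] [Fintype F] {net : Network N F} {x : N → F → ℝ}

theorem Network.sum_mbpRate_mul [DecidableEq F] (q : N → F → ℝ) (φ : N → N → F)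
    (σ : Schedule N) :
    ∑ n, ∑ m, ∑ f, net.mbpRate q φ σ n m f * (q n f - q m f) = net.mbpWeight q φ σ := by
  refine Finset.sum_congr rfl fun n _ => Finset.sum_congr rfl fun m _ => ?_
  refine Finset.sum_eq_single _ (fun f _ hf => ?_) (by simp)
  simp [Network.mbpRate, hf]

variable [DecidableEq N]

/-- The stranded indicator is constant along edges, so no schedule can drain it and the outer bound
holds with `M = 0`. The value 1 of `D` off the edges is harmless, as there is no capacity there. -/
theorem Network.eq_zero_of_stranded {y : N → F → ℝ} (hy : y ∈ net.capacityRegion)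
    (hy0 : ∀ n f, 0 ≤ y n f) {n : N} {f : F} (h : net.Stranded n f) : y n f = 0 := by
  classical
  have h1 := net.sum_mul_le_of_mem_capacityRegion hy net.strandedInd_nonneg net.strandedInd_dest
    (D := fun n m => if net.graph.Adj n m then 0 else 1) (fun n m => by split_ifs <;> norm_num)
    (fun n m f => by
      split_ifs with hnm
      · rw [net.strandedInd_congr hnm, sub_self]
      · linarith [net.strandedInd_le_one n f, net.strandedInd_nonneg m f])
    (M := 0) (fun σ hσ => (Finset.sum_eq_zero fun n _ => Finset.sum_eq_zero fun m _ => by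
      split_ifs with hnm
      · simp
      · simp [hσ.cap_eq_zero hnm]).le)
  have h0 : ∀ n f, 0 ≤ net.strandedInd n f * y n f := fun n f =>
    mul_nonneg (net.strandedInd_nonneg n f) (hy0 n f)
  have h2 := (Finset.single_le_sum (f := fun f => net.strandedInd n f * y n f)
    (fun f _ => h0 n f) (Finset.mem_univ f)).trans
      (Finset.single_le_sum (f := fun n => ∑ f, net.strandedInd n f * y n f)
        (fun n _ => Finset.sum_nonneg fun f _ => h0 n f) (Finset.mem_univ n))
  have h3 : net.strandedInd n f = 1 := if_pos h
  rw [h3, one_mul] at h2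
  exact le_antisymm (h2.trans h1) (hy0 n f)

/-- Inside the capacity region, the total back pressure of Maximum Back Pressure exceeds the
arrival rate weighted with the queues by a multiple of the total queue length, up to a constant
and as long as the queues that cannot be served stay bounded. -/
theorem Network.exists_backPressure_ge [DecidableEq F] {ε : ℝ} (hε : 0 < ε)
    (hx : (1 + ε) • x ∈ net.capacityRegion) :
    ∃ δ : ℝ, 0 < δ ∧ ∀ Q : ℝ, 0 ≤ Q → ∃ C : ℝ, 0 ≤ C ∧ ∀ (q : N → F → ℝ) (σ : Schedule N)
      (c : N → N → F → ℝ), net.IsMBPDecision q σ c → (∀ n f, 0 ≤ q n f) →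
      (∀ n f, n ∈ net.dest f → q n f = 0) → (∀ n f, net.Stranded n f → q n f ≤ Q) →
      ∑ n, ∑ f, q n f * x n f + δ * ∑ n, ∑ f, q n f ≤
        ∑ n, ∑ m, ∑ f, c n m f * (q n f - q m f) + C := by
  -- `κ` depends on the network alone, so `δ` can be fixed before `Q`; stranded pairs are covered by
  -- the additive `Q`.
  have hκ : ∀ n f, ∃ κ : ℝ, 0 ≤ κ ∧ ∀ (Q : ℝ) (q : N → F → ℝ) (W : ℝ), 0 ≤ Q → 0 ≤ W →
      (∀ n f, n ∈ net.dest f → q n f = 0) → (∀ n f, net.Stranded n f → q n f ≤ Q) →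
      (∀ k l, net.graph.Adj k l → net.linkRate k l 1 * (q k f - q l f) ≤ W) →
      q n f ≤ κ * W + Q := by
    intro n f
    by_cases hs : net.Stranded n f
    · exact ⟨0, le_rfl, fun Q q W _ _ _ h _ => by simpa using h n f hs⟩
    · unfold Network.Stranded at hs
      push Not at hs
      obtain ⟨d, hd, hnd⟩ := hs
      obtain ⟨κ, hκ, H⟩ := net.exists_queue_le_of_reachable hnd
      refine ⟨κ, hκ, fun Q q W hQ _ h0 _ hW => ?_⟩
      have := H (fun k => q k f) W (h0 d f hd) hW
      linarith
  choose κ hκ0 hκ using hκ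
  set K := ∑ n, ∑ f, κ n f with hK
  have hK0 : 0 ≤ K := Finset.sum_nonneg fun n _ => Finset.sum_nonneg fun f _ => hκ0 n f
  -- The outer bound gives `q · x ≤ U / (1 + ε)`, leaving a margin `ε / (1 + ε) * U`, while `|q|₁ ≤
  -- K * U + G`. Thus `δ * K ≤ ε / (1 + ε)` is what is needed; `K + 1` avoids division by zero.
  refine ⟨ε / ((1 + ε) * (K + 1)), by positivity, fun Q hQ => ?_⟩
  set δ := ε / ((1 + ε) * (K + 1)) with hδ
  have hδ0 : 0 < δ := by positivity
  set G : ℝ := ∑ _n : N, ∑ _f : F, Q with hG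
  have hG0 : 0 ≤ G := Finset.sum_nonneg fun n _ => Finset.sum_nonneg fun f _ => hQ
  refine ⟨net.totalRate ^ 2 + δ * G, by positivity, fun q σ c hdec hq hqd hqs => ?_⟩
  obtain ⟨φ, hφ, hσ, hmax, rfl⟩ := hdec
  rw [Network.sum_mbpRate_mul]
  have hpos := fun τ (hτ : net.Feasible τ) =>
    Network.sum_cap_mul_posPart_le (σ := τ) hq hmax hτ
  set U := net.mbpWeight q φ σ + net.totalRate ^ 2 with hU
  have hU0 : 0 ≤ U := le_trans (Finset.sum_nonneg fun n _ => Finset.sum_nonneg fun m _ =>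
    mul_nonneg (hσ.cap_nonneg n m) (le_max_right _ _)) (hpos σ hσ)
  have hX := net.sum_mul_le_of_mem_capacityRegion hx hq hqd
    (D := fun n m => max (q n (φ n m) - q m (φ n m)) 0) (fun n m => le_max_right _ _)
    (fun n m f => (hφ n m f).trans (le_max_left _ _)) hpos
  have e : ∑ n, ∑ f, q n f * ((1 + ε) • x) n f = (1 + ε) * ∑ n, ∑ f, q n f * x n f := by
    simp_rw [Finset.mul_sum]
    refine Finset.sum_congr rfl fun n _ => Finset.sum_congr rfl fun f _ => ?_
    simp only [Pi.smul_apply, smul_eq_mul]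
    ring
  rw [e] at hX
  have hS : ∑ n, ∑ f, q n f ≤ K * U + G := by
    rw [hK, hG]
    simp_rw [Finset.sum_mul, ← Finset.sum_add_distrib]
    exact Finset.sum_le_sum fun n _ => Finset.sum_le_sum fun f _ =>
      hκ n f Q q U hQ hU0 hqd hqs fun k l hkl => Network.linkRate_mul_sub_le hφ hpos hkl f
  set X := ∑ n, ∑ f, q n f * x n f
  have h1 : X ≤ U / (1 + ε) := by rw [le_div_iff₀ (by positivity)]; linarith
  have h2 : δ * ∑ n, ∑ f, q n f ≤ δ * (K * U + G) := mul_le_mul_of_nonneg_left hS hδ0.le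
  have h3 : δ * (K * U) ≤ ε / (1 + ε) * U := by
    rw [← mul_assoc]
    refine mul_le_mul_of_nonneg_right ?_ hU0
    rw [hδ, div_mul_eq_mul_div, div_le_div_iff₀ (by positivity) (by positivity)]
    have : 0 < ε * (1 + ε) := by positivity
    nlinarith
  have h4 : U / (1 + ε) + ε / (1 + ε) * U = U := by field_simp
  linarith [mul_add δ (K * U) G]

end MBP

/-! ### Drift of the potential and stability. -/

section Stability

variable {N F : Type*} [Fintype N] [DecidableEq N] [Fintype F] {net : Network N F} {Ω : Type*}
  [MeasurableSpace Ω] {μ : Measure Ω} {x : N → F → ℝ}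

namespace Operation

variable (R : Operation net μ x)

theorem mean_nonneg (R : Operation net μ x) (n : N) (f : F) : 0 ≤ x n f := by
  rw [← R.a_mean 0 n f]
  exact integral_nonneg fun ω => R.a_nonneg 0 ω n f

theorem ae_eq_zero_of_mean (h : ∀ n f, net.Stranded n f → x n f = 0) :
    ∀ᵐ ω ∂μ, ∀ t n f, net.Stranded n f → R.a t ω n f = 0 := by
  simp only [ae_all_iff]
  intro t n f hs
  have := (integral_eq_zero_iff_of_nonneg (fun ω => R.a_nonneg t ω n f)
    (R.a_integrable t n f)).1 ((R.a_mean t n f).trans (h n f hs))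
  exact this

/-- Links never join stranded and other pairs, so without arrivals the total stranded queue is
conserved. -/
theorem q_le_of_stranded {ω : Ω} (h : ∀ t n f, net.Stranded n f → R.a t ω n f = 0) (t : ℕ) {n : N}
    {f : F} (hs : net.Stranded n f) : R.q t ω n f ≤ ∑ n, ∑ f, R.q₀ n f := by
  have key : ∑ n, ∑ f, net.strandedInd n f * R.q t ω n f ≤ ∑ n, ∑ f, R.q₀ n f := by
    induction t with
    | zero =>
      rw [R.q_zero]
      exact Finset.sum_le_sum fun n _ => Finset.sum_le_sum fun f _ =>
        mul_le_of_le_one_left (R.q₀_nonneg n f) (net.strandedInd_le_one n f)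
    | succ t ih =>
      rw [R.sum_mul_q_succ net.strandedInd_dest]
      have h1 : ∑ n, ∑ m, ∑ f, R.c t ω n m f * (net.strandedInd n f - net.strandedInd m f) = 0 :=
        Finset.sum_eq_zero fun n _ => Finset.sum_eq_zero fun m _ => Finset.sum_eq_zero fun f _ => by
          by_cases hnm : net.graph.Adj n m
          · rw [net.strandedInd_congr hnm, sub_self, mul_zero]
          · rw [R.c_eq_zero t ω hnm, zero_mul]
      have h2 : ∑ n, ∑ f, net.strandedInd n f * R.a t ω n f = 0 :=
        Finset.sum_eq_zero fun n _ => Finset.sum_eq_zero fun f _ => by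
          by_cases hnf : net.Stranded n f
          · rw [h t n f hnf, mul_zero]
          · rw [Network.strandedInd, if_neg hnf, zero_mul]
      linarith
  have h0 : ∀ n f, 0 ≤ net.strandedInd n f * R.q t ω n f := fun n f =>
    mul_nonneg (net.strandedInd_nonneg n f) (R.q_nonneg t ω n f)
  have h2 := (Finset.single_le_sum (f := fun f => net.strandedInd n f * R.q t ω n f)
    (fun f _ => h0 n f) (Finset.mem_univ f)).trans
      (Finset.single_le_sum (f := fun n => ∑ f, net.strandedInd n f * R.q t ω n f)
        (fun n _ => Finset.sum_nonneg fun f _ => h0 n f) (Finset.mem_univ n))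
  have h3 : net.strandedInd n f = 1 := if_pos hs
  rw [h3, one_mul] at h2
  exact h2.trans key

/-- A smooth version of the Euclidean norm of the queue vector. -/
noncomputable def potential (B : ℝ) (t : ℕ) (ω : Ω) : ℝ := √(B ^ 2 + ∑ n, ∑ f, R.q t ω n f ^ 2)

theorem sum_sq_q_nonneg (t : ℕ) (ω : Ω) : 0 ≤ ∑ n, ∑ f, R.q t ω n f ^ 2 :=
  Finset.sum_nonneg fun _ _ => Finset.sum_nonneg fun _ _ => sq_nonneg _

theorem le_potential {B : ℝ} (t : ℕ) (ω : Ω) : B ≤ R.potential B t ω :=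
  Real.le_sqrt_of_sq_le (by linarith [R.sum_sq_q_nonneg t ω])

theorem q_le_potential {B : ℝ} (t : ℕ) (ω : Ω) (n : N) (f : F) :
    R.q t ω n f ≤ R.potential B t ω := by
  refine Real.le_sqrt_of_sq_le ?_
  have := (Finset.single_le_sum (f := fun f => R.q t ω n f ^ 2)
    (fun f _ => sq_nonneg _) (Finset.mem_univ f)).trans
      (Finset.single_le_sum (f := fun n => ∑ f, R.q t ω n f ^ 2)
        (fun n _ => Finset.sum_nonneg fun f _ => sq_nonneg _) (Finset.mem_univ n))
  linarith [sq_nonneg B]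

theorem potential_le {B : ℝ} (hB : 0 < B) (t : ℕ) (ω : Ω) :
    R.potential B t ω ≤ B + ∑ n, ∑ f, R.q t ω n f := by
  have h := sqrt_add_sum_sq_add_le (ι := N × F) (fun _ => 0) (fun p => R.q t ω p.1 p.2)
    (fun p => R.q_nonneg t ω p.1 p.2) B
  simp only [Fintype.sum_prod_type, zero_add] at h
  simpa [potential, Real.sqrt_sq hB.le] using h

/-- Mean of the arrivals of one frame truncated at level `K`. -/
noncomputable def truncMean (K : ℝ) (n : N) (f : F) : ℝ := ∫ ω, min (R.a 0 ω n f) K ∂μ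

/-- Martingale part of the growth of the potential. -/
noncomputable def fluctuation (B K : ℝ) (n : N) (f : F) (t : ℕ) (ω : Ω) : ℝ :=
  R.q t ω n f / R.potential B t ω * (min (R.a t ω n f) K - R.truncMean K n f)

theorem integrable_min_a (K : ℝ) (hK : 0 ≤ K) (t : ℕ) (n : N) (f : F) :
    Integrable (fun ω => min (R.a t ω n f) K) μ := by
  have hm : Measurable fun ω => min (R.a t ω n f) K :=
    ((measurable_pi_apply f).comp ((measurable_pi_apply n).comp (R.a_measurable' t))).min
      measurable_const
  refine (R.a_integrable t n f).mono' hm.aestronglyMeasurable (ae_of_all _ fun ω => ?_)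
  rw [Real.norm_of_nonneg (le_min (R.a_nonneg t ω n f) hK)]
  exact min_le_left _ _

theorem truncMean_le {K : ℝ} (hK : 0 ≤ K) (n : N) (f : F) : R.truncMean K n f ≤ x n f := by
  rw [← R.a_mean 0 n f]
  exact integral_mono (R.integrable_min_a K hK 0 n f) (R.a_integrable 0 n f)
    fun ω => min_le_left _ _

theorem integral_min_a (K : ℝ) (t : ℕ) (n : N) (f : F) :
    ∫ ω, min (R.a t ω n f) K ∂μ = R.truncMean K n f := by
  have hg : Measurable fun a : N → F → ℝ => min (a n f) K := by fun_prop
  exact ((R.a_identDistrib t).comp hg).integral_eq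

variable [IsProbabilityMeasure μ]

/-- The factor `q / potential` lies in `[0, 1]` and is known before the frame, while the centred
truncated arrival is independent of the past. The products are therefore bounded by `K` and
orthogonal. -/
theorem ae_tendsto_fluctuation {B K : ℝ} (hB : 0 < B) (hK : 0 ≤ K) (n : N) (f : F) :
    ∀ᵐ ω ∂μ, Tendsto (fun T : ℕ => (∑ t ∈ Finset.range T, R.fluctuation B K n f t ω) / T) atTop
      (nhds 0) := by
  have hh : ∀ t, Measurable[R.ℱ t] fun ω => R.q t ω n f / R.potential B t ω := by
    intro t
    have hg : Measurable fun q : N → F → ℝ => q n f / √(B ^ 2 + ∑ n, ∑ f, q n f ^ 2) := by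
      fun_prop
    exact hg.comp (R.q_measurable t)
  have hgb : Measurable fun a : N → F → ℝ => min (a n f) K - R.truncMean K n f := by fun_prop
  have hD : ∀ t, Measurable[R.ℱ (t + 1)] (R.fluctuation B K n f t) := fun t =>
    ((hh t).mono (R.ℱ.mono (Nat.le_succ t)) le_rfl).mul (hgb.comp (R.a_measurable t))
  have hm0 : 0 ≤ R.truncMean K n f := integral_nonneg fun ω => le_min (R.a_nonneg 0 ω n f) hK
  have hmK : R.truncMean K n f ≤ K := by
    calc _ ≤ ∫ _, K ∂μ := integral_mono (R.integrable_min_a K hK 0 n f) (integrable_const K)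
          fun ω => min_le_right _ _
      _ = K := by simp
  refine ae_tendsto_average_of_orthogonal (fun t => (hD t).mono (R.ℱ.le _) le_rfl) (K := K)
    (fun t ω => ?_) fun s t hst => ?_
  · have hp : 0 < R.potential B t ω := hB.trans_le (R.le_potential t ω)
    rw [fluctuation, abs_mul]
    have h1 : |R.q t ω n f / R.potential B t ω| ≤ 1 := by
      rw [abs_of_nonneg (div_nonneg (R.q_nonneg t ω n f) hp.le), div_le_one hp]
      exact R.q_le_potential t ω n f
    have h2 : |min (R.a t ω n f) K - R.truncMean K n f| ≤ K := by
      have := le_min (R.a_nonneg t ω n f) hK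
      have := min_le_right (R.a t ω n f) K
      rw [abs_le]
      constructor <;> linarith
    calc _ ≤ 1 * K := mul_le_mul h1 h2 (abs_nonneg _) zero_le_one
      _ = K := one_mul K
  · have hY : Measurable[R.ℱ t] fun ω =>
        R.fluctuation B K n f s ω * (R.q t ω n f / R.potential B t ω) :=
      ((hD s).mono (R.ℱ.mono hst) le_rfl).mul (hh t)
    have hb := hgb.comp (R.a_measurable' t)
    have hind := ((R.a_indepFun t hY).comp hgb measurable_id).symm
    have hY' := hY.mono (R.ℱ.le t) le_rfl
    have h := hind.integral_mul_eq_mul_integral hY'.aestronglyMeasurable hb.aestronglyMeasurable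
    have hz : ∫ ω, (min (R.a t ω n f) K - R.truncMean K n f) ∂μ = 0 := by
      rw [integral_sub (R.integrable_min_a K hK t n f) (integrable_const _), R.integral_min_a]
      simp
    calc _ = ∫ ω, R.fluctuation B K n f s ω * (R.q t ω n f / R.potential B t ω) *
          (min (R.a t ω n f) K - R.truncMean K n f) ∂μ := by
          refine integral_congr_ae (ae_of_all _ fun ω => ?_)
          simp only [fluctuation]
          ring
      _ = _ := h
      _ = 0 := by
          rw [show (∫ ω, ((fun a : N → F → ℝ => min (a n f) K - R.truncMean K n f) ∘ R.a t) ω ∂μ)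
            = 0 from hz, mul_zero]

omit [IsProbabilityMeasure μ] in
/-- The mean of the arrivals in excess of a level vanishes as the level grows. -/
theorem exists_excess_lt {η : ℝ} (hη : 0 < η) :
    ∃ K : ℝ, 0 ≤ K ∧ Integrable (fun ω => ∑ n, ∑ f, (R.a 0 ω n f - min (R.a 0 ω n f) K)) μ ∧
      ∫ ω, ∑ n, ∑ f, (R.a 0 ω n f - min (R.a 0 ω n f) K) ∂μ < η := by
  have hi : ∀ K : ℕ, Integrable (fun ω => ∑ n, ∑ f, (R.a 0 ω n f - min (R.a 0 ω n f) K)) μ :=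
    fun K => integrable_finsetSum _ fun n _ => integrable_finsetSum _ fun f _ =>
      (R.a_integrable 0 n f).sub (R.integrable_min_a K K.cast_nonneg 0 n f)
  have hlim : Tendsto (fun K : ℕ => ∫ ω, ∑ n, ∑ f, (R.a 0 ω n f - min (R.a 0 ω n f) K) ∂μ) atTop
      (nhds (∫ _, (0 : ℝ) ∂μ)) := by
    refine tendsto_integral_of_dominated_convergence (fun ω => ∑ n, ∑ f, R.a 0 ω n f)
      (fun K => (hi K).aestronglyMeasurable)
      (integrable_finsetSum _ fun n _ => integrable_finsetSum _ fun f _ => R.a_integrable 0 n f)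
      (fun K => ae_of_all _ fun ω => ?_) (ae_of_all _ fun ω => ?_)
    · have h0 : ∀ n f, 0 ≤ R.a 0 ω n f - min (R.a 0 ω n f) K := fun n f =>
        sub_nonneg.2 (min_le_left _ _)
      rw [Real.norm_of_nonneg (Finset.sum_nonneg fun n _ => Finset.sum_nonneg fun f _ => h0 n f)]
      exact Finset.sum_le_sum fun n _ => Finset.sum_le_sum fun f _ =>
        sub_le_self _ (le_min (R.a_nonneg 0 ω n f) K.cast_nonneg)
    · refine tendsto_const_nhds.congr' ?_
      have : ∀ᶠ K : ℕ in atTop, ∀ n f, R.a 0 ω n f ≤ K := by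
        simp only [eventually_all]
        exact fun n f => tendsto_natCast_atTop_atTop.eventually_ge_atTop _
      filter_upwards [this] with K hK
      exact (Finset.sum_eq_zero fun n _ => Finset.sum_eq_zero fun f _ => by
        rw [min_eq_left (hK n f), sub_self]).symm
  rw [integral_zero] at hlim
  obtain ⟨K, hK⟩ := (hlim.eventually_lt_const hη).exists
  exact ⟨K, K.cast_nonneg, hi K, hK⟩

omit [IsProbabilityMeasure μ] in
/-- One-frame growth of the potential. -/
theorem potential_succ_le {B K : ℝ} (hB : 0 < B) (hK : 0 ≤ K) (t : ℕ) (ω : Ω) :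
    R.potential B (t + 1) ω ≤ R.potential B t ω +
      (∑ n, ∑ f, R.q t ω n f * min (R.a t ω n f) K -
        ∑ n, ∑ m, ∑ f, R.c t ω n m f * (R.q t ω n f - R.q t ω m f)) / R.potential B t ω +
      (∑ _n : N, ∑ _f : F, (net.totalRate + K) ^ 2) / (2 * B) +
      ∑ n, ∑ f, (R.a t ω n f - min (R.a t ω n f) K) := by
  have h := sqrt_add_sum_sq_add_add_le (ι := N × F) (fun p => R.q t ω p.1 p.2)
    (fun p => ∑ m, (R.c t ω m p.1 p.2 - R.c t ω p.1 m p.2) + min (R.a t ω p.1 p.2) K)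
    (fun p => R.a t ω p.1 p.2 - min (R.a t ω p.1 p.2) K)
    (fun p => sub_nonneg.2 (min_le_left _ _)) hB
  simp only [Fintype.sum_prod_type] at h
  have h1 : R.potential B (t + 1) ω ≤ √(B ^ 2 + ∑ n, ∑ f, (R.q t ω n f +
      (∑ m, (R.c t ω m n f - R.c t ω n m f) + min (R.a t ω n f) K) +
        (R.a t ω n f - min (R.a t ω n f) K)) ^ 2) := by
    refine Real.sqrt_le_sqrt (add_le_add_right (Finset.sum_le_sum fun n _ =>
      Finset.sum_le_sum fun f _ => ?_) _)
    rw [R.q_succ]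
    -- At a destination the new queue is 0, while the right-hand side keeps a square; hence only an
    -- inequality.
    split_ifs
    · rw [zero_pow two_ne_zero]; exact sq_nonneg _
    · exact le_of_eq (by ring)
  have h2 : ∑ n, ∑ f, R.q t ω n f *
      (∑ m, (R.c t ω m n f - R.c t ω n m f) + min (R.a t ω n f) K) =
      ∑ n, ∑ f, R.q t ω n f * min (R.a t ω n f) K -
        ∑ n, ∑ m, ∑ f, R.c t ω n m f * (R.q t ω n f - R.q t ω m f) := by
    simp_rw [mul_add, Finset.sum_add_distrib]
    rw [sum_mul_netInflow]
    ring
  have h3 : ∑ n, ∑ f, (∑ m, (R.c t ω m n f - R.c t ω n m f) + min (R.a t ω n f) K) ^ 2 ≤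
      ∑ _n : N, ∑ _f : F, (net.totalRate + K) ^ 2 := by
    refine Finset.sum_le_sum fun n _ => Finset.sum_le_sum fun f _ => ?_
    refine sq_le_sq' ?_ ?_ <;>
      linarith [abs_le.1 (R.abs_netInflow_le t ω n f), min_le_right (R.a t ω n f) K,
        le_min (R.a_nonneg t ω n f) hK]
  rw [h2] at h
  have h4 := div_le_div_of_nonneg_right h3 (show 0 ≤ 2 * B by positivity)
  have h5 := h1.trans h
  unfold potential at h5 ⊢
  linarith

omit [IsProbabilityMeasure μ] in
/-- One-frame drift of the potential under sufficient back pressure. -/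
theorem potential_drift {B K δ C : ℝ} (hB : 0 < B) (hK : 0 ≤ K) (hδ : 0 < δ) (hC : 0 ≤ C) {t : ℕ}
    {ω : Ω} (h : ∑ n, ∑ f, R.q t ω n f * x n f + δ * ∑ n, ∑ f, R.q t ω n f ≤
      ∑ n, ∑ m, ∑ f, R.c t ω n m f * (R.q t ω n f - R.q t ω m f) + C) :
    R.potential B (t + 1) ω + δ / 2 * (if B < ∑ n, ∑ f, R.q t ω n f then 1 else 0) ≤
      R.potential B t ω + ∑ n, ∑ f, R.fluctuation B K n f t ω +
      (C + (∑ _n : N, ∑ _f : F, (net.totalRate + K) ^ 2) / 2) / B +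
      ∑ n, ∑ f, (R.a t ω n f - min (R.a t ω n f) K) := by
  have h1 := R.potential_succ_le hB hK t ω
  have hBs : B ≤ R.potential B t ω := R.le_potential t ω
  have hs0 : 0 < R.potential B t ω := hB.trans_le hBs
  have hfl : ∑ n, ∑ f, R.fluctuation B K n f t ω =
      (∑ n, ∑ f, R.q t ω n f * min (R.a t ω n f) K -
        ∑ n, ∑ f, R.q t ω n f * R.truncMean K n f) / R.potential B t ω := by
    simp_rw [← Finset.sum_sub_distrib, Finset.sum_div]
    refine Finset.sum_congr rfl fun n _ => Finset.sum_congr rfl fun f _ => ?_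
    rw [fluctuation]
    ring
  have hmean : ∑ n, ∑ f, R.q t ω n f * R.truncMean K n f ≤ ∑ n, ∑ f, R.q t ω n f * x n f :=
    Finset.sum_le_sum fun n _ => Finset.sum_le_sum fun f _ =>
      mul_le_mul_of_nonneg_left (R.truncMean_le hK n f) (R.q_nonneg t ω n f)
  -- Above level `B` the potential is at most `2 |q|₁`, so division by it leaves at least `δ / 2` of
  -- the drift.
  have hind : R.potential B t ω / 2 * (if B < ∑ n, ∑ f, R.q t ω n f then 1 else 0) ≤
      ∑ n, ∑ f, R.q t ω n f := by
    have := R.potential_le hB t ω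
    split_ifs
    · linarith
    · simpa using Finset.sum_nonneg fun n _ => Finset.sum_nonneg fun f _ => R.q_nonneg t ω n f
  set I : ℝ := if B < ∑ n, ∑ f, R.q t ω n f then 1 else 0
  set s := R.potential B t ω
  have h2 := mul_le_mul_of_nonneg_left hind hδ.le
  have h3 : (∑ n, ∑ f, R.q t ω n f * min (R.a t ω n f) K -
        ∑ n, ∑ m, ∑ f, R.c t ω n m f * (R.q t ω n f - R.q t ω m f)) / s ≤
      ∑ n, ∑ f, R.fluctuation B K n f t ω + C / s - δ / 2 * I := by
    rw [hfl, ← add_div, div_le_iff₀ hs0, sub_mul, div_mul_cancel₀ _ hs0.ne']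
    linarith
  have h4 : C / s ≤ C / B := div_le_div_of_nonneg_left hC hB hBs
  have h5 : (C + (∑ _n : N, ∑ _f : F, (net.totalRate + K) ^ 2) / 2) / B =
      C / B + (∑ _n : N, ∑ _f : F, (net.totalRate + K) ^ 2) / (2 * B) := by
    field_simp
  linarith

theorem IsMBP.stable [DecidableEq F] {R : Operation net μ x} (hR : R.IsMBP) {ε : ℝ} (hε : 0 < ε)
    (hx : (1 + ε) • x ∈ net.capacityRegion) : R.Stable := by
  obtain ⟨δ, hδ, H⟩ := Network.exists_backPressure_ge hε hx
  have hQ : 0 ≤ ∑ n, ∑ f, R.q₀ n f :=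
    Finset.sum_nonneg fun n _ => Finset.sum_nonneg fun f _ => R.q₀_nonneg n f
  obtain ⟨C, hC, H⟩ := H _ hQ
  have hx0 : ∀ n f, net.Stranded n f → x n f = 0 := fun n f hs => by
    have h1 := net.eq_zero_of_stranded hx
      (fun n f => mul_nonneg (by positivity) (R.mean_nonneg n f)) hs
    simp only [Pi.smul_apply, smul_eq_mul, mul_eq_zero] at h1
    exact h1.resolve_left (by positivity)
  have hdrift : ∀ᵐ ω ∂μ, ∀ t, ∑ n, ∑ f, R.q t ω n f * x n f + δ * ∑ n, ∑ f, R.q t ω n f ≤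
      ∑ n, ∑ m, ∑ f, R.c t ω n m f * (R.q t ω n f - R.q t ω m f) + C := by
    filter_upwards [R.ae_eq_zero_of_mean hx0] with ω hω t
    exact H _ _ _ (hR t ω) (R.q_nonneg t ω) (fun n f => R.q_dest t ω)
      fun n f hs => R.q_le_of_stranded hω t hs
  have main : ∀ η : ℝ, 0 < η → ∀ᵐ ω ∂μ, ∃ B : ℝ, ∀ᶠ T : ℕ in atTop,
      (({t ∈ Finset.range T | B < ∑ n, ∑ f, R.q t ω n f}.card : ℕ) : ℝ) ≤ η * T := by
    intro η hη
    -- Four errors are each made at most `κ` per frame: second-order term, excess arrivals,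
    -- fluctuation and initial potential. The budget `δ / 2 * η` equals `5 * κ`.
    set κ := δ * η / 10 with hκ
    have hκ0 : 0 < κ := by positivity
    obtain ⟨K, hK, hKi, hKη⟩ := R.exists_excess_lt hκ0
    set P := C + (∑ _n : N, ∑ _f : F, (net.totalRate + K) ^ 2) / 2 with hP
    have hP0 : 0 ≤ P := by positivity
    set B := (P + 1) / κ with hBdef
    have hB : 0 < B := by positivity
    have hPB : P / B ≤ κ := by
      rw [div_le_iff₀ hB, hBdef, mul_div_cancel₀ _ hκ0.ne']
      linarith
    have hfl : ∀ᵐ ω ∂μ, ∀ n f, Tendsto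
        (fun T : ℕ => (∑ t ∈ Finset.range T, R.fluctuation B K n f t ω) / T) atTop (nhds 0) := by
      simp only [ae_all_iff]
      exact fun n f => R.ae_tendsto_fluctuation hB hK n f
    have hex := R.ae_tendsto_average (fun a => ∑ n, ∑ f, (a n f - min (a n f) K)) (by fun_prop) hKi
    filter_upwards [hdrift, hfl, hex] with ω h1 h2 h3
    refine ⟨B, ?_⟩
    have h4 : Tendsto (fun T : ℕ => (∑ t ∈ Finset.range T,
        ∑ n, ∑ f, R.fluctuation B K n f t ω) / T) atTop (nhds 0) := by
      have := tendsto_finsetSum Finset.univ fun n _ =>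
        tendsto_finsetSum Finset.univ fun f (_ : f ∈ Finset.univ) => h2 n f
      simp only [Finset.sum_const_zero] at this
      refine this.congr fun T => ?_
      simp_rw [← Finset.sum_div]
      congr 1
      symm
      rw [Finset.sum_comm (s := Finset.range T)]
      exact Finset.sum_congr rfl fun n _ => Finset.sum_comm
    have hsum : ∀ T : ℕ, δ / 2 * (({t ∈ Finset.range T | B < ∑ n, ∑ f, R.q t ω n f}.card : ℕ) : ℝ) +
        R.potential B T ω ≤
        R.potential B 0 ω + ∑ t ∈ Finset.range T, ∑ n, ∑ f, R.fluctuation B K n f t ω + T * (P / B)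
          + ∑ t ∈ Finset.range T, ∑ n, ∑ f, (R.a t ω n f - min (R.a t ω n f) K) := by
      intro T
      rw [Finset.card_filter]
      push_cast
      induction T with
      | zero => simp
      | succ T ih =>
        have := R.potential_drift hB hK hδ hC (h1 T)
        simp only [Finset.sum_range_succ]
        push_cast
        linarith
    have h5 : Tendsto (fun T : ℕ => R.potential B 0 ω / T) atTop (nhds 0) :=
      tendsto_const_nhds.div_atTop tendsto_natCast_atTop_atTop
    filter_upwards [h3.eventually_lt_const hKη, h4.eventually_lt_const hκ0,
      h5.eventually_lt_const hκ0, eventually_gt_atTop 0] with T e1 e2 e3 e4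
    have hT : (0 : ℝ) < T := by exact_mod_cast e4
    rw [div_lt_iff₀ hT] at e1 e2 e3
    have e5 := hsum T
    have e6 : 0 < R.potential B T ω := hB.trans_le (R.le_potential T ω)
    have e7 : T * (P / B) ≤ T * κ := mul_le_mul_of_nonneg_left hPB hT.le
    have e8 : δ / 2 * (({t ∈ Finset.range T | B < ∑ n, ∑ f, R.q t ω n f}.card : ℕ) : ℝ) ≤
        δ / 2 * (η * T) := by
      have : δ / 2 * (η * T) = 5 * (κ * T) := by rw [hκ]; ring
      nlinarith
    exact le_of_mul_le_mul_left e8 (by positivity)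
  -- The exceptional null set depends on `η`; countably many values `1 / (k + 1)` suffice for a
  -- common one.
  have hall : ∀ᵐ ω ∂μ, ∀ k : ℕ, ∃ B : ℝ, ∀ᶠ T : ℕ in atTop,
      (({t ∈ Finset.range T | B < ∑ n, ∑ f, R.q t ω n f}.card : ℕ) : ℝ) ≤
        1 / ((k : ℝ) + 1) * T :=
    ae_all_iff.2 fun k => main _ (by positivity)
  filter_upwards [hall] with ω hω η hη
  obtain ⟨k, hk⟩ := exists_nat_one_div_lt hη
  obtain ⟨B, hB⟩ := hω k
  refine ⟨B, hB.mono fun T hT => hT.trans ?_⟩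
  exact mul_le_mul_of_nonneg_right hk.le T.cast_nonneg

end Operation

end Stability

end MmWave

theorem proposition1 {N F : Type*} [Fintype N] [DecidableEq N] [Fintype F] [DecidableEq F]
    (net : MmWave.Network N F) (x : N → F → ℝ)
    (hx : ∃ ε : ℝ, 0 < ε ∧ (1 + ε) • x ∈ net.capacityRegion)
    {Ω : Type*} [MeasurableSpace Ω] (μ : MeasureTheory.Measure Ω)
    [MeasureTheory.IsProbabilityMeasure μ]
    (R : MmWave.Operation net μ x) (hR : R.IsMBP) :
    R.Stable := by
  obtain ⟨ε, hε, hxε⟩ := hx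
  exact hR.stable hε hxε
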